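/- Let $k$ be an ordered field and $G$ an ordered (totally ordered, abelian) group. Let $v_G\colon G\to\Gamma\cup\{\infty\}$ be the natural valuation of $G$: $v_G(g)\le v_G(h)$ iff $|h|\le n|g|$ for some $n\in\mathbb N$, where $\Gamma=v_G(G\setminus\{0\})$ is the value chain of $G$. For $\gamma\in\Gamma$ let $B_\gamma=\{g: v_G(g)\ge\gamma\}/\{g: v_G(g)>\gamma\}$, with the order induced from $G$. Let $K=k((G))$ be the field of generalized power series $\sum_{g\in G}a_gt^g$ with well-ordered support, with the valuation $v(a)=\min\operatorname{supp}(a)$, ordered by: $a<b$ iff $a_g<b_g$ for $g=v(a-b)$. Then the following are equivalent. (A) There exists a Hardy-type derivation $D$ on $K$. (B) Both of the following hold: (1) for each $\gamma\in\Gamma$, $B_\gamma$ embeds as an ordered group into $(k,+,\le)$; (2) there exists a strictly increasing map $\sigma\colon\Gamma\to G^{\le 0}=\{g\in G: g\le 0\}$ which is a right-shift, i.e. $v_G(\sigma(\gamma))>\gamma$ for all $\gamma\in\Gamma$. Here a derivation $D$ on $K$, with constants $\mathcal C=\{c\in K: D(c)=0\}$, is called of Hardy type if $(K,\le,D)$ is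 an H-field with valuation $v$ and its asymptotic couple $(G,\psi)$ is of Hardy type. That $(K,\le,D)$ is an H-field with valuation $v$ means, with $\mathcal O=\{a: v(a)\ge0\}$ and $\mathfrak m=\{a: v(a)>0\}$: - $\mathcal O=\{a\in K: |a|\le c\text{ for some }c\in\mathcal C\}$, $\mathcal O=\mathcal C+\mathfrak m$, and $\mathcal O$ is convex; - $v(D(a))>v(D(b)/b)$ for all $a\in\mathcal O$ and $0\ne b\in\mathfrak m$; - $D(a)>0$ for every $a\in K$ with $a>\mathcal O$. The asymptotic couple of $(K,\le,D)$ is $(G,\psi)$, where $\psi\colon G\setminus\{0\}\to G$ is given by $\psi(v(a))=v(D(a)/a)$ for $a\ne0$, $v(a)\ne0$. It is of Hardy type if it is an H-type asymptotic couple, i.e. for all non-zero $g,h\in G$: $\psi(g+h)\ge\min(\psi(g),\psi(h))$ if $g+h\neq0$; $\psi(ng)=\psi(g)$ for all integers $n\ge1$; $\psi(g)<\psi(h)+|h|$; $g\le h<0\Rightarrow\psi(g)\le\psi(h)$; and moreover $\psi(g)=\psi(h)$ implies $v_G(g)=v_G(h)$. -/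

import Mathlib

open scoped Pointwise

/-! ### Ordered abelian groups: value chain, components, right-shifts

For an ordered abelian group `G`, `ArchimedeanClass.mk : G → ArchimedeanClass G` is the natural
valuation `v_G : G → Γ ∪ {∞}` (`mk g ≤ mk h ↔ ∃ n, |h| ≤ n • |g|`, and `⊤ = mk 0` is `∞`), and
`FiniteArchimedeanClass G` is the value chain `Γ = v_G (G \ {0})`. -/

/-- The component `G^γ / G_γ` of `G` at `γ ∈ Γ`, where `G^γ = {g | v_G g ≥ γ}` and
`G_γ = {g | v_G g > γ}`. -/
def ArchComponent {G : Type*} [AddCommGroup G] [LinearOrder G] [IsOrderedAddMonoid G]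
    (γ : FiniteArchimedeanClass G) : Type _ :=
  FiniteArchimedeanClass.closedBallAddSubgroup γ ⧸
    (FiniteArchimedeanClass.ballAddSubgroup γ).addSubgroupOf
      (FiniteArchimedeanClass.closedBallAddSubgroup γ)

namespace ArchComponent

variable {G : Type*} [AddCommGroup G] [LinearOrder G] [IsOrderedAddMonoid G]
  {γ : FiniteArchimedeanClass G}

noncomputable instance : AddCommGroup (ArchComponent γ) :=
  inferInstanceAs (AddCommGroup (FiniteArchimedeanClass.closedBallAddSubgroup γ ⧸
    (FiniteArchimedeanClass.ballAddSubgroup γ).addSubgroupOf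
      (FiniteArchimedeanClass.closedBallAddSubgroup γ)))

/-- The class of an element of `G^γ` in the component. -/
noncomputable def mk (g : FiniteArchimedeanClass.closedBallAddSubgroup γ) : ArchComponent γ :=
  QuotientAddGroup.mk g

/-- The order induced by the order of `G` on the quotient by the convex subgroup `G_γ`. -/
noncomputable instance : LE (ArchComponent γ) where
  le x y := ∃ g h : FiniteArchimedeanClass.closedBallAddSubgroup γ,
    mk g = x ∧ mk h = y ∧ g ≤ h

theorem mk_le_mk {g h : FiniteArchimedeanClass.closedBallAddSubgroup γ} :
    mk g ≤ mk h ↔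
      ((g - h : G) ∈ FiniteArchimedeanClass.ballAddSubgroup γ ∨
        ((g - h : G) ∉ FiniteArchimedeanClass.ballAddSubgroup γ ∧ g ≤ h)) := by
  have hq : ∀ a b : FiniteArchimedeanClass.closedBallAddSubgroup γ,
      mk a = mk b ↔ (a - b : G) ∈ FiniteArchimedeanClass.ballAddSubgroup γ := by
    intro a b
    refine (eq_comm.trans (QuotientAddGroup.eq (a := b) (b := a))).trans ?_
    rw [AddSubgroup.mem_addSubgroupOf]
    simp only [AddSubgroup.coe_add, AddSubgroup.coe_neg]
    rw [neg_add_eq_sub]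
  constructor
  · rintro ⟨a, b, ha, hb, hab⟩
    by_cases hgh : (g - h : G) ∈ FiniteArchimedeanClass.ballAddSubgroup γ
    · exact Or.inl hgh
    refine Or.inr ⟨hgh, ?_⟩
    by_contra hlt
    have hlt' : (h : G) < g := not_le.mp hlt
    have hab' : (a : G) ≤ b := hab
    apply hgh
    have h1 := (hq a g).1 ha
    have h2 := (hq b h).1 hb
    have h3 : ((b - h) - (a - g) : G) ∈ FiniteArchimedeanClass.ballAddSubgroup γ :=
      sub_mem h2 h1
    rw [FiniteArchimedeanClass.mem_ballAddSubgroup_iff] at h3 ⊢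
    intro hne
    have h4 : |(g - h : G)| ≤ |((b - h) - (a - g) : G)| := by
      rw [abs_of_pos (sub_pos.2 hlt')]
      refine le_trans ?_ (le_abs_self _)
      have : ((b - h) - (a - g) : G) = (g - h) + (b - a) := by abel
      rw [this]
      exact le_add_of_nonneg_right (sub_nonneg.2 hab')
    have h5 : ((b - h) - (a - g) : G) ≠ 0 := by
      intro h0
      rw [h0, abs_zero] at h4
      exact hne (abs_nonpos_iff.1 h4)
    exact lt_of_lt_of_le (h3 h5) (ArchimedeanClass.mk_le_mk_of_abs h4)
  · rintro (h1 | ⟨-, h1⟩)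
    · exact ⟨h, h, ((hq g h).2 h1).symm, rfl, le_rfl⟩
    · exact ⟨g, h, rfl, rfl, h1⟩

end ArchComponent

/-- `B_γ` embeds as an ordered group into `(k, +, ≤)`. -/
def ArchComponent.EmbedsInto {G : Type*} [AddCommGroup G] [LinearOrder G] [IsOrderedAddMonoid G]
    (γ : FiniteArchimedeanClass G) (k : Type*) [AddCommGroup k] [LE k] : Prop :=
  ∃ u : ArchComponent γ →+ k, ∀ x y : ArchComponent γ, u x ≤ u y ↔ x ≤ y

/-- A map `σ : Γ → G^{≤ 0}` is a right-shift if `v_G (σ γ) > γ` for all `γ ∈ Γ`. -/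
def IsRightShift {G : Type*} [AddCommGroup G] [LinearOrder G] [IsOrderedAddMonoid G]
    (σ : FiniteArchimedeanClass G → {g : G // g ≤ 0}) : Prop :=
  ∀ γ : FiniteArchimedeanClass G, γ.val < ArchimedeanClass.mk (σ γ : G)

/-! ### Asymptotic couples -/

/-- `(G, ψ)` is an asymptotic couple. -/
structure IsAsymptoticCouple {G : Type*} [AddCommGroup G] [LinearOrder G] [IsOrderedAddMonoid G]
    (ψ : {g : G // g ≠ 0} → G) : Prop where
  min_le : ∀ g h s : {g : G // g ≠ 0}, (s : G) = g + h → min (ψ g) (ψ h) ≤ ψ s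
  nsmul : ∀ (g s : {g : G // g ≠ 0}) (n : ℕ), (s : G) = n • (g : G) → ψ s = ψ g
  lt_add_abs : ∀ g h : {g : G // g ≠ 0}, ψ g < ψ h + |(h : G)|

/-- `(G, ψ)` is an H-type asymptotic couple. -/
structure IsHTypeCouple {G : Type*} [AddCommGroup G] [LinearOrder G] [IsOrderedAddMonoid G]
    (ψ : {g : G // g ≠ 0} → G) : Prop extends IsAsymptoticCouple ψ where
  mono_neg : ∀ g h : {g : G // g ≠ 0}, (g : G) ≤ h → (h : G) < 0 → ψ g ≤ ψ h

/-- `ψ` is of Hardy type: `(G, ψ)` is of H-type and `ψ g = ψ h` implies `v_G g = v_G h`. -/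
structure IsHardyTypeCouple {G : Type*} [AddCommGroup G] [LinearOrder G] [IsOrderedAddMonoid G]
    (ψ : {g : G // g ≠ 0} → G) : Prop extends IsHTypeCouple ψ where
  mk_eq : ∀ g h : {g : G // g ≠ 0}, ψ g = ψ h →
    ArchimedeanClass.mk (g : G) = ArchimedeanClass.mk (h : G)

/-! ### H-fields

`v : K → G ∪ {∞}` is a valuation on the field `K`, with valuation ring `{a | 0 ≤ v a}` and maximal
ideal `{a | 0 < v a}`; a derivation on `K` is a `ℤ`-linear one, i.e. an additive map satisfying the
Leibniz rule. -/

section Fields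

variable {K G : Type*} [Field K] [AddCommGroup G] [LinearOrder G] [IsOrderedAddMonoid G]

/-- `(K, v, D)` is a pre-differential-valued field. -/
def IsPreDifferentialValued (v : AddValuation K (WithTop G)) (D : Derivation ℤ K K) : Prop :=
  ∀ a b : K, 0 ≤ v a → 0 < v b → b ≠ 0 → v (D b / b) < v (D a)

/-- `(K, v, ≤, D)` is a pre-H-field. -/
structure IsPreHField [LinearOrder K] [IsStrictOrderedRing K]
    (v : AddValuation K (WithTop G)) (D : Derivation ℤ K K) : Prop where
  preDifferentialValued : IsPreDifferentialValued v D
  convex : {a : K | 0 ≤ v a}.OrdConnected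
  deriv_pos : ∀ a : K, (∀ b : K, 0 ≤ v b → b < a) → 0 < D a

/-- `(K, ≤, D)` is an H-field and `v` is its valuation, i.e. the valuation whose ring consists of
the elements bounded in absolute value by a constant. -/
structure IsHField [LinearOrder K] [IsStrictOrderedRing K]
    (v : AddValuation K (WithTop G)) (D : Derivation ℤ K K) : Prop extends IsPreHField v D where
  valuationRing_eq : {a : K | 0 ≤ v a} = {a : K | ∃ c : K, D c = 0 ∧ |a| ≤ c}
  eq_constants_add : {a : K | 0 ≤ v a} = {c : K | D c = 0} + {a : K | 0 < v a}

/-- `G` is the value group of `(K, v)` and `ψ` is the map induced on `G \ {0}` by the logarithmic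
derivative: `ψ (v a) = v (D a / a)` whenever `v a ≠ 0, ∞`. -/
def HasAsymptoticCouple (v : AddValuation K (WithTop G)) (D : Derivation ℤ K K)
    (ψ : {g : G // g ≠ 0} → G) : Prop :=
  Function.Surjective v ∧
    ∀ (a : K) (g : {g : G // g ≠ 0}), v a = ((g : G) : WithTop G) →
      v (D a / a) = (ψ g : WithTop G)

/-- `D` is a Hardy-type derivation on the ordered field `K`, with respect to the valuation `v`:
`(K, ≤, D)` is an H-field with valuation `v`, and the map `ψ` of its asymptotic couple `(G, ψ)`
is of Hardy type. -/
def IsHardyTypeDerivation [LinearOrder K] [IsStrictOrderedRing K]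
    (v : AddValuation K (WithTop G)) (D : Derivation ℤ K K) : Prop :=
  IsHField v D ∧ ∃ ψ : {g : G // g ≠ 0} → G, HasAsymptoticCouple v D ψ ∧ IsHardyTypeCouple ψ

end Fields

/-- The field `k((G))` of generalized power series, ordered by the sign of the leading coefficient:
`a < b` iff `a_g < b_g` for `g = v (a - b)`. -/
abbrev OrderedPowerSeries (k G : Type*) [Field k] [LinearOrder k] [IsStrictOrderedRing k]
    [AddCommGroup G] [LinearOrder G] [IsOrderedAddMonoid G] : Type _ :=
  Lex (HahnSeries G k)

/-- The usual valuation `v a = min (supp a)` on `k((G))`. -/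
noncomputable def powerSeriesVal (k G : Type*) [Field k] [LinearOrder k] [IsStrictOrderedRing k]
    [AddCommGroup G] [LinearOrder G] [IsOrderedAddMonoid G] :
    AddValuation (OrderedPowerSeries k G) (WithTop G) :=
  AddValuation.of (fun a => (ofLex a).orderTop)
    (HahnSeries.addVal G k).map_zero (HahnSeries.addVal G k).map_one
    (HahnSeries.addVal G k).map_add (HahnSeries.addVal G k).map_mul

/-! From a derivation to (B): `g ↦ D (t ^ g) / t ^ g` is additive and has value `ψ g` at `g ≠ 0`.
The Hardy-type condition makes `ψ` factor through a strictly increasing `s : Γ → G`. The coefficient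
at `s γ` of the negated logarithmic derivative kills `G_γ` and is positive on the other positive
elements of `G^γ`, so it embeds `B_γ` into `k` (`embedsInto_of_isHardyTypeDerivation`). The
right-shift comes from `s` alone (`exists_isRightShift_of_strictMono`).

From (B) to a derivation: Hahn's embedding and the maps `B_γ → k` give additive coordinates `g_γ ∈
k` of `g ∈ G`. Set `D (t ^ g) = -∑ γ, g_γ t ^ (g + σ γ)` and extend to all series. The family is
summable by `HahnCoordinates.not_antitone`. The leading exponent of `D (t ^ g)` is `g + σ (v_G g)`,
strictly increasing in `g ≠ 0` (`IsRightShift.add_lt_add`), so leading terms cannot cancel: the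
constants are exactly the series `r t ^ 0`, and `ψ = σ ∘ v_G`. -/

section Group

variable {G : Type*} [AddCommGroup G] [LinearOrder G] [IsOrderedAddMonoid G]

/-! ### Embeddings of components as homomorphisms on `G^γ` -/

theorem ArchComponent.embedsInto_of_addMonoidHom {k : Type*} [AddCommGroup k] [LinearOrder k]
    [IsOrderedAddMonoid k] {γ : FiniteArchimedeanClass G}
    (f : FiniteArchimedeanClass.closedBallAddSubgroup γ →+ k)
    (hzero : ∀ g : FiniteArchimedeanClass.closedBallAddSubgroup γ,
      (g : G) ∈ FiniteArchimedeanClass.ballAddSubgroup γ → f g = 0)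
    (hpos : ∀ g : FiniteArchimedeanClass.closedBallAddSubgroup γ,
      (g : G) ∉ FiniteArchimedeanClass.ballAddSubgroup γ → 0 < g → 0 < f g) :
    ArchComponent.EmbedsInto γ k := by
  refine ⟨QuotientAddGroup.lift _ f fun g hg => hzero g hg, fun x y => ?_⟩
  obtain ⟨g, rfl⟩ := QuotientAddGroup.mk_surjective x
  obtain ⟨h, rfl⟩ := QuotientAddGroup.mk_surjective y
  refine Iff.trans ?_ (ArchComponent.mk_le_mk (g := g) (h := h)).symm
  change f g ≤ f h ↔ _
  by_cases hm : (g - h : G) ∈ FiniteArchimedeanClass.ballAddSubgroup γ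
  · have := hzero (g - h) hm
    rw [map_sub, sub_eq_zero] at this
    simp [hm, this]
  · simp only [hm, false_or, not_false_eq_true, true_and]
    rcases lt_trichotomy g h with hlt | heq | hgt
    · have := hpos (h - g) (fun h' => hm (by simpa using neg_mem h')) (sub_pos.2 hlt)
      rw [map_sub, sub_pos] at this
      exact iff_of_true this.le hlt.le
    · simp [heq]
    · have := hpos (g - h) hm (sub_pos.2 hgt)
      rw [map_sub, sub_pos] at this
      exact iff_of_false this.not_ge hgt.not_ge

theorem ArchComponent.EmbedsInto.exists_addMonoidHom {k : Type*} [AddCommGroup k] [LinearOrder k]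
    [IsOrderedAddMonoid k] {γ : FiniteArchimedeanClass G} (h : ArchComponent.EmbedsInto γ k) :
    ∃ f : FiniteArchimedeanClass.closedBallAddSubgroup γ →+ k,
      (∀ g : FiniteArchimedeanClass.closedBallAddSubgroup γ,
        (g : G) ∈ FiniteArchimedeanClass.ballAddSubgroup γ → f g = 0) ∧
      ∀ g : FiniteArchimedeanClass.closedBallAddSubgroup γ,
        (g : G) ∉ FiniteArchimedeanClass.ballAddSubgroup γ → 0 < g → 0 < f g := by
  obtain ⟨u, hu⟩ := h
  let π : FiniteArchimedeanClass.closedBallAddSubgroup γ →+ ArchComponent γ :=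
    QuotientAddGroup.mk' _
  have key : ∀ g : FiniteArchimedeanClass.closedBallAddSubgroup γ, u (π g) ≤ 0 ↔
      ((g : G) ∈ FiniteArchimedeanClass.ballAddSubgroup γ ∨
        ((g : G) ∉ FiniteArchimedeanClass.ballAddSubgroup γ ∧ g ≤ 0)) := by
    intro g
    have h0 : u (π 0) = 0 := by simp
    rw [← h0, hu]
    refine (ArchComponent.mk_le_mk (g := g) (h := 0)).trans ?_
    simp
  refine ⟨u.comp π, fun g hg => ?_, fun g hg hpos => ?_⟩
  · refine le_antisymm ((key g).2 (Or.inl hg)) ?_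
    have := (key (-g)).2 (Or.inl (by simpa using hg))
    simpa using this
  · by_contra hcon
    rcases (key g).1 (not_lt.1 hcon) with h1 | ⟨-, h1⟩
    · exact hg h1
    · exact hpos.not_ge h1

/-! ### Right-shifts from Hardy-type couples -/

theorem FiniteArchimedeanClass.lt_mk_of_forall_abs_lt {γ : FiniteArchimedeanClass G} {d : G}
    (h : ∀ x : G, x ≠ 0 → ArchimedeanClass.mk x = γ.val → |d| < |x|) :
    γ.val < ArchimedeanClass.mk d := by
  obtain ⟨x, hx⟩ := ArchimedeanClass.mk_surjective G γ.val
  have hx0 : x ≠ 0 := by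
    rintro rfl
    exact γ.prop (by simpa using hx.symm)
  refine lt_of_le_of_ne (hx ▸ ArchimedeanClass.mk_le_mk_of_abs (h x hx0 hx).le) fun heq => ?_
  by_cases hd : d = 0
  · exact γ.prop (by simp [heq, hd])
  · exact lt_irrefl _ (h d hd heq.symm)

/-- The trichotomy for asymptotic couples: either every value of `ψ` has an asymptotic integral, or
`ψ` attains a maximum. In both cases a right-shift results. -/
theorem exists_isRightShift_of_strictMono {s : FiniteArchimedeanClass G → G} (hs : StrictMono s)
    (hlt : ∀ (γ : FiniteArchimedeanClass G) (h : G) (hh : h ≠ 0),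
      s γ < s (FiniteArchimedeanClass.mk h hh) + |h|) :
    ∃ σ : FiniteArchimedeanClass G → {g : G // g ≤ 0}, StrictMono σ ∧ IsRightShift σ := by
  have hshift : ∀ {γ δ : FiniteArchimedeanClass G}, γ < δ →
      γ.val < ArchimedeanClass.mk (s γ - s δ) := by
    intro γ δ hγδ
    refine FiniteArchimedeanClass.lt_mk_of_forall_abs_lt fun x hx hxγ => ?_
    have hmk : FiniteArchimedeanClass.mk x hx = γ := Subtype.ext hxγ
    rw [abs_sub_comm, abs_of_pos (sub_pos.2 (hs hγδ)), sub_lt_iff_lt_add']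
    simpa [hmk] using hlt δ x hx
  -- An `x` with `s γ = x + s (v_G x)` plays the role of an asymptotic integral of `s γ`. If all
  -- exist, `γ ↦ x` is the right-shift; a `γ₀` without one turns out to maximize `s`, and then `s -
  -- s γ₀` is.
  by_cases hint : ∀ γ, ∃ x, ∃ hx : x ≠ 0, s γ = x + s (FiniteArchimedeanClass.mk x hx)
  · choose f hf0 hf using hint
    have hneg : ∀ γ, f γ < 0 := by
      intro γ
      by_contra hcon
      have := hlt γ (f γ) (hf0 γ)
      rw [abs_of_nonneg (not_lt.1 hcon), add_comm, ← hf γ] at this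
      exact lt_irrefl _ this
    have hclass : ∀ γ, γ < FiniteArchimedeanClass.mk (f γ) (hf0 γ) := by
      intro γ
      by_contra hcon
      have h1 := hs.monotone (not_lt.1 hcon)
      rw [hf γ] at h1
      exact absurd h1 (not_le.2 (add_lt_of_neg_left _ (hneg γ)))
    refine ⟨fun γ => ⟨f γ, (hneg γ).le⟩, fun γ δ hγδ => ?_, fun γ => hclass γ⟩
    change f γ < f δ
    by_contra hcon
    have h1 : f δ ≤ f γ := not_lt.1 hcon
    have h2 : FiniteArchimedeanClass.mk (f δ) (hf0 δ) ≤ FiniteArchimedeanClass.mk (f γ) (hf0 γ) :=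
      ArchimedeanClass.mk_monotoneOn (hneg δ).le (hneg γ).le h1
    have h3 := add_le_add h1 (hs.monotone h2)
    rw [← hf, ← hf] at h3
    exact h3.not_gt (hs hγδ)
  · push Not at hint
    obtain ⟨γ₀, hγ₀⟩ := hint
    have hmax : ∀ γ, s γ ≤ s γ₀ := by
      by_contra! hcon
      obtain ⟨γ, hγ⟩ := hcon
      have hne : ∀ {δ}, s γ₀ < s δ → s γ₀ - s δ ≠ 0 := fun h => (sub_neg.2 h).ne
      have hstep : ∀ {δ ε : FiniteArchimedeanClass G} (hδ : s γ₀ < s δ)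
          (_ : ε = FiniteArchimedeanClass.mk _ (hne hδ)), s γ₀ < s ε := by
        rintro δ ε hδ rfl
        exact hs (hshift (hs.lt_iff_lt.1 hδ))
      -- With `ε = v_G (s γ₀ - s δ) ≤ δ`, replacing `s δ` by `s ε` changes the difference only by an
      -- element of class above `ε`. So `s γ₀ - s ε` still has class `ε` and is an integral of `s
      -- γ₀`.
      have hcontra : ∀ {δ : FiniteArchimedeanClass G} (hδ : s γ₀ < s δ),
          FiniteArchimedeanClass.mk _ (hne hδ) ≤ δ → False := by
        intro δ hδ hle
        set ε := FiniteArchimedeanClass.mk _ (hne hδ) with hε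
        have hsε := hstep hδ hε
        have hmk : FiniteArchimedeanClass.mk _ (hne hsε) = ε := by
          rcases hle.eq_or_lt with heq | hlt'
          · apply Subtype.ext
            change ArchimedeanClass.mk (s γ₀ - s ε) = ArchimedeanClass.mk (s γ₀ - s δ)
            rw [heq]
          · apply Subtype.ext
            have h1 : ε.val < ArchimedeanClass.mk (s ε - s δ) := hshift hlt'
            have h2 : s γ₀ - s ε = (s γ₀ - s δ) - (s ε - s δ) := by abel
            change ArchimedeanClass.mk (s γ₀ - s ε) = ArchimedeanClass.mk (s γ₀ - s δ)
            rw [h2]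
            exact ArchimedeanClass.mk_sub_eq_mk_left h1
        refine hγ₀ _ (hne hsε) ?_
        rw [hmk]
        abel
      set ε := FiniteArchimedeanClass.mk _ (hne hγ) with hε
      -- If `ε > γ`, pass from `γ` to `ε`: `s γ₀ - s ε` is more negative than `s γ₀ - s γ`, hence of
      -- class at most `ε`, and `hcontra` applies to `ε`.
      rcases le_or_gt ε γ with hle | hgt
      · exact hcontra hγ hle
      · have hsε := hstep hγ hε
        refine hcontra hsε ?_
        exact ArchimedeanClass.mk_monotoneOn (sub_neg.2 hsε).le (sub_neg.2 hγ).le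
          (sub_le_sub_left (hs hgt).le _)
    refine ⟨fun γ => ⟨s γ - s γ₀, sub_nonpos.2 (hmax γ)⟩,
      fun γ δ h => sub_lt_sub_right (hs h) _, fun γ => ?_⟩
    rcases (hs.le_iff_le.1 (hmax γ)).eq_or_lt with rfl | h
    · simpa using lt_top_iff_ne_top.2 γ.prop
    · exact hshift h

/-- If `|h| ≤ n |g|`, then `-n |g| ≤ -|h| < 0`, and monotonicity on negatives compares the values of
`ψ`. Evenness of `ψ` is a separate hypothesis because `nsmul` covers natural multiples only. -/
theorem IsHardyTypeCouple.exists_strictMono {ψ : {g : G // g ≠ 0} → G}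
    (hψ : IsHardyTypeCouple ψ) (hneg : ∀ g h : {g : G // g ≠ 0}, (h : G) = -g → ψ h = ψ g) :
    ∃ s : FiniteArchimedeanClass G → G, StrictMono s ∧
      ∀ g : {g : G // g ≠ 0}, s (FiniteArchimedeanClass.mk g.1 g.2) = ψ g := by
  have hmono : ∀ (g h : {g : G // g ≠ 0}),
      ArchimedeanClass.mk (g : G) ≤ ArchimedeanClass.mk (h : G) → ψ g ≤ ψ h := by
    have habs : ∀ g : {g : G // g ≠ 0}, ∃ g' : {g : G // g ≠ 0}, (g' : G) = -|(g : G)| ∧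
        ψ g' = ψ g := by
      intro g
      rcases abs_choice (g : G) with h | h
      · exact ⟨⟨-|(g : G)|, by simpa using g.2⟩, rfl, hneg _ _ (by simp [h])⟩
      · exact ⟨g, by simp [h], rfl⟩
    intro g h hgh
    obtain ⟨g', hg', hψg⟩ := habs g
    obtain ⟨h', hh', hψh⟩ := habs h
    obtain ⟨n, hn⟩ := ArchimedeanClass.mk_le_mk.1 hgh
    have hh'neg : (h' : G) < 0 := by
      rw [hh']
      simpa using h.2
    have hle : n • (g' : G) ≤ h' := by
      rw [hg', hh', smul_neg]
      exact neg_le_neg hn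
    have hne : n • (g' : G) ≠ 0 := (hle.trans_lt hh'neg).ne
    rw [← hψg, ← hψh, ← hψ.nsmul g' ⟨n • (g' : G), hne⟩ n rfl]
    exact hψ.mono_neg _ _ hle hh'neg
  have hout : ∀ γ : FiniteArchimedeanClass G, γ.val.out ≠ 0 := by
    intro γ h0
    have := ArchimedeanClass.mk_out γ.val
    rw [h0] at this
    exact γ.prop (by simpa using this.symm)
  refine ⟨fun γ => ψ ⟨γ.val.out, hout γ⟩, fun γ δ hγδ => ?_, fun g => ?_⟩
  · refine lt_of_le_of_ne (hmono _ _ ?_) fun heq => ?_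
    · simpa using hγδ.le
    · have := hψ.mk_eq _ _ heq
      simp only [ArchimedeanClass.mk_out] at this
      exact hγδ.ne (Subtype.ext this)
  · exact le_antisymm (hmono _ _ (by simp)) (hmono _ _ (by simp))

theorem IsHardyTypeCouple.exists_isRightShift {ψ : {g : G // g ≠ 0} → G}
    (hψ : IsHardyTypeCouple ψ) (hneg : ∀ g h : {g : G // g ≠ 0}, (h : G) = -g → ψ h = ψ g) :
    ∃ σ : FiniteArchimedeanClass G → {g : G // g ≤ 0}, StrictMono σ ∧ IsRightShift σ := by
  obtain ⟨s, hs, hsψ⟩ := hψ.exists_strictMono hneg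
  refine exists_isRightShift_of_strictMono hs fun γ h hh => ?_
  induction γ using FiniteArchimedeanClass.ind with
  | mk g hg =>
    rw [hsψ ⟨g, hg⟩, hsψ ⟨h, hh⟩]
    exact hψ.lt_add_abs _ _

end Group

/-! ### Coordinates of `G` with values in `k` -/

section Coordinates

variable (k G : Type*) [Field k] [LinearOrder k] [IsStrictOrderedRing k]
  [AddCommGroup G] [LinearOrder G] [IsOrderedAddMonoid G]

/-- A system of additive coordinate maps `G → k`, one for each element of the value chain, as
provided by an embedding of `G` into a Hahn product of its components. -/
structure HahnCoordinates where
  /-- The coordinate at `γ`. -/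
  coord : FiniteArchimedeanClass G → G →+ k
  isWF_support : ∀ g, {γ | coord γ g ≠ 0}.IsWF
  coord_eq_zero : ∀ γ g, γ.val < ArchimedeanClass.mk g → coord γ g = 0
  coord_mk_pos : ∀ (g : G) (hg : 0 < g), 0 < coord (FiniteArchimedeanClass.mk g hg.ne') g

variable {k G}

theorem HahnCoordinates.nonempty_of_embedsInto
    (h : ∀ γ : FiniteArchimedeanClass G, ArchComponent.EmbedsInto γ k) :
    Nonempty (HahnCoordinates k G) := by
  obtain ⟨f, -, hf⟩ := hahnEmbedding_isOrderedAddMonoid G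
  let r : FiniteArchimedeanClass G → G →+ ℝ := fun γ =>
    { toFun := fun g => (ofLex (f g)).coeff γ
      map_zero' := by simp
      map_add' := fun a b => by simp }
  have hr : ∀ γ g, γ.val < ArchimedeanClass.mk g → r γ g = 0 := by
    intro γ g hγ
    apply HahnSeries.coeff_eq_zero_of_lt_orderTop
    rw [hf, ← FiniteArchimedeanClass.withTopOrderIso_apply_coe, OrderIso.lt_iff_lt] at hγ
    exact hγ
  have hr' : ∀ g (hg : g ≠ 0), r (FiniteArchimedeanClass.mk g hg) g ≠ 0 := by
    intro g hg
    apply HahnSeries.coeff_orderTop_ne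
    rw [← (FiniteArchimedeanClass.withTopOrderIso G).apply_eq_iff_eq, ← hf]
    rfl
  choose u hu0 hupos using fun γ => (h γ).exists_addMonoidHom
  -- The group `k` is divisible, so the map `B_γ → k` extends along `B_γ → ℝ` to all real
  -- coordinates. The extension `l` need not preserve order; positivity is needed only for the
  -- leading coordinate, where `l ∘ r` agrees with `u`.
  have hext : ∀ γ, ∃ l : ℝ →+ k, ∀ g : FiniteArchimedeanClass.closedBallAddSubgroup γ,
      l (r γ (g : G)) = u γ g := by
    intro γ
    let ι : ArchComponent γ →+ ℝ := QuotientAddGroup.lift _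
      ((r γ).comp (FiniteArchimedeanClass.closedBallAddSubgroup γ).subtype) (by
        intro g hg
        by_cases hg0 : (g : G) = 0
        · simp [hg0]
        · exact hr γ g (FiniteArchimedeanClass.mem_ballAddSubgroup_iff.1
            (AddSubgroup.mem_addSubgroupOf.1 hg) hg0))
    let w : ArchComponent γ →+ k := QuotientAddGroup.lift _ (u γ) fun g hg => hu0 γ g hg
    have hι : Function.Injective ι := by
      rw [injective_iff_map_eq_zero]
      intro x hx
      obtain ⟨g, rfl⟩ := QuotientAddGroup.mk_surjective x
      refine (QuotientAddGroup.eq_zero_iff g).2 (AddSubgroup.mem_addSubgroupOf.2 ?_)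
      refine FiniteArchimedeanClass.mem_ballAddSubgroup_iff.2 fun hg0 => ?_
      refine lt_of_le_of_ne (FiniteArchimedeanClass.mem_closedBallAddSubgroup_iff.1 g.2 hg0) ?_
      intro heq
      exact hr' g hg0 (heq ▸ hx)
    obtain ⟨l, hl⟩ := (Module.Baer.of_divisible k).extension_property_addMonoidHom ι hι w
    exact ⟨l, fun g => DFunLike.congr_fun hl (ArchComponent.mk g)⟩
  choose l hl using hext
  refine ⟨⟨fun γ => (l γ).comp (r γ), fun g => ?_, fun γ g hγ => by simp [hr γ g hγ],
    fun g hg => ?_⟩⟩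
  · refine (ofLex (f g)).isPWO_support.isWF.mono fun γ hγ h0 => hγ ?_
    rw [AddMonoidHom.comp_apply, show r γ g = 0 from h0, map_zero]
  · set γ := FiniteArchimedeanClass.mk g hg.ne'
    have hmem : g ∈ FiniteArchimedeanClass.closedBallAddSubgroup γ :=
      FiniteArchimedeanClass.mem_closedBallAddSubgroup_iff.2 fun _ => le_rfl
    rw [AddMonoidHom.comp_apply, hl γ ⟨g, hmem⟩]
    refine hupos γ ⟨g, hmem⟩ (fun hb => ?_) hg
    exact lt_irrefl _ (FiniteArchimedeanClass.mem_ballAddSubgroup_iff.1 hb hg.ne')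

end Coordinates

/-! ### Hardy-type couples from right-shifts -/

section Shift

variable {G : Type*} [AddCommGroup G] [LinearOrder G] [IsOrderedAddMonoid G]

/-- The only case in which `σ` could reverse the order is `v_G x < v_G g`. Then `x - g` has the
class of `x`, while `σ (v_G x)` is of strictly higher class and so too small to cancel it. -/
theorem IsRightShift.add_lt_add {σ : FiniteArchimedeanClass G → {g : G // g ≤ 0}}
    (hσ : StrictMono σ) (hs : IsRightShift σ) {g x : G} (hg : g ≠ 0) (hx : x ≠ 0) (hgx : g < x) :
    g + (σ (FiniteArchimedeanClass.mk g hg) : G) < x + (σ (FiniteArchimedeanClass.mk x hx) : G) := by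
  set γ := FiniteArchimedeanClass.mk g hg
  set ξ := FiniteArchimedeanClass.mk x hx
  rcases le_or_gt γ ξ with hle | hlt
  · exact add_lt_add_of_lt_of_le hgx (hσ.monotone hle)
  · have hmk : ArchimedeanClass.mk (x - g) = ξ.val := ArchimedeanClass.mk_sub_eq_mk_left hlt
    have h1 : (-(σ ξ : G)) < x - g := by
      refine ArchimedeanClass.lt_of_mk_lt_mk_of_nonneg ?_ (sub_pos.2 hgx).le
      rw [hmk, ArchimedeanClass.mk_neg]
      exact hs ξ
    have h2 : g < x + (σ ξ : G) := by
      rw [neg_lt_iff_pos_add] at h1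
      rw [← sub_pos]
      convert h1 using 1
      abel
    exact (add_le_of_nonpos_right (σ γ).2).trans_lt h2

theorem IsRightShift.lt_add_abs {σ : FiniteArchimedeanClass G → {g : G // g ≤ 0}}
    (hσ : StrictMono σ) (hs : IsRightShift σ) (γ : FiniteArchimedeanClass G) {g : G} (hg : g ≠ 0) :
    (σ γ : G) < (σ (FiniteArchimedeanClass.mk g hg) : G) + |g| := by
  set ξ := FiniteArchimedeanClass.mk g hg
  rcases le_or_gt γ ξ with hle | hlt
  · exact lt_add_of_le_of_pos (hσ.monotone hle) (abs_pos.2 hg)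
  · refine (σ γ).2.trans_lt (neg_lt_iff_pos_add'.1 ?_)
    refine ArchimedeanClass.lt_of_mk_lt_mk_of_nonneg ?_ (abs_nonneg g)
    rw [ArchimedeanClass.mk_neg, ArchimedeanClass.mk_abs]
    exact hs ξ

theorem IsRightShift.isHardyTypeCouple {σ : FiniteArchimedeanClass G → {g : G // g ≤ 0}}
    (hσ : StrictMono σ) (hs : IsRightShift σ) :
    IsHardyTypeCouple fun g : {g : G // g ≠ 0} => (σ (FiniteArchimedeanClass.mk g.1 g.2) : G) where
  min_le g h s hgh := by
    have hmin : min (FiniteArchimedeanClass.mk g.1 g.2) (FiniteArchimedeanClass.mk h.1 h.2) ≤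
        FiniteArchimedeanClass.mk s.1 s.2 := by
      have := ArchimedeanClass.min_le_mk_add g.1 h.1
      rw [← hgh, min_le_iff] at this
      exact min_le_iff.2 this
    rcases min_le_iff.1 hmin with h' | h'
    · exact min_le_of_left_le (hσ.monotone h')
    · exact min_le_of_right_le (hσ.monotone h')
  nsmul g s n hs' := by
    have hn : n ≠ 0 := by
      rintro rfl
      exact s.2 (by simpa using hs')
    congr 2
    apply Subtype.ext
    change ArchimedeanClass.mk s.1 = ArchimedeanClass.mk g.1
    rw [hs']
    refine ArchimedeanClass.mk_eq_mk.2 ⟨⟨1, ?_⟩, ⟨n, by rw [abs_nsmul]⟩⟩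
    rw [one_nsmul, abs_nsmul]
    exact le_self_nsmul (abs_nonneg _) hn
  lt_add_abs g h := hs.lt_add_abs hσ _ h.2
  mono_neg g h hgh hh := hσ.monotone (ArchimedeanClass.mk_monotoneOn (hgh.trans hh.le) hh.le hgh)
  mk_eq g h hgh := congrArg Subtype.val (hσ.injective (Subtype.ext hgh))

end Shift

/-! ### Diagonal derivations and the summability argument -/

section CoeffDerivation

variable {k G : Type*} [Field k] [AddCommGroup G] [LinearOrder G] [IsOrderedAddMonoid G]

/-- The derivation `t ^ g ↦ φ g • t ^ g` of `k((G))`. -/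
noncomputable def coeffDerivation (φ : G →+ k) : Derivation ℤ (HahnSeries G k) (HahnSeries G k) :=
  Derivation.mk' (AddMonoidHom.toIntLinearMap
    { toFun := fun a =>
        { coeff := fun g => φ g * a.coeff g
          isPWO_support' := a.isPWO_support.mono fun g hg h0 => hg (by simp [h0]) }
      map_zero' := by ext; simp
      map_add' := fun a b => by ext; simp [mul_add] }) (by
    intro a b
    ext g
    have hsub : ∀ c : HahnSeries G k, ∀ h : (Function.support fun g => φ g * c.coeff g).IsPWO,
        (HahnSeries.mk (fun g => φ g * c.coeff g) h).support ⊆ c.support :=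
      fun c h g hg h0 => hg (by simp [h0])
    simp only [AddMonoidHom.coe_toIntLinearMap, AddMonoidHom.coe_mk, ZeroHom.coe_mk, smul_eq_mul,
      HahnSeries.coeff_add]
    rw [mul_comm b]
    -- All three convolutions are summed over the same pairs from the supports of `a` and `b`; there
    -- the Leibniz rule is `φ (i + j) = φ i + φ j`.
    rw [HahnSeries.coeff_mul, HahnSeries.coeff_mul_right' b.isPWO_support (hsub b _),
      HahnSeries.coeff_mul_left' a.isPWO_support (hsub a _), Finset.mul_sum,
      ← Finset.sum_add_distrib]
    refine Finset.sum_congr rfl fun ij hij => ?_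
    rw [← (Finset.mem_antidiagonal.1 hij).2.2, map_add]
    ring)

@[simp]
theorem coeff_coeffDerivation (φ : G →+ k) (a : HahnSeries G k) (g : G) :
    (coeffDerivation φ a).coeff g = φ g * a.coeff g := rfl

end CoeffDerivation

/-- On a subsequence `x` is nondecreasing, so `σ ∘ γ` is nonincreasing and, by injectivity of the
pairs, `γ` strictly decreases. Moreover `0 ≤ x n - x 0 ≤ -σ (γ n)`, so the right-shift property
makes `x n` and `x 0` agree at coordinate `γ n`. Thus the well-ordered coordinate support of `x 0`
contains an infinite descending sequence. This yields both conditions for summability. -/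
theorem HahnCoordinates.not_antitone {k G : Type*} [Field k] [LinearOrder k]
    [AddCommGroup G] [LinearOrder G] [IsOrderedAddMonoid G] (c : HahnCoordinates k G)
    {σ : FiniteArchimedeanClass G → {g : G // g ≤ 0}} (hσ : StrictMono σ) (hs : IsRightShift σ)
    {S : Set G} (hS : S.IsPWO) (x : ℕ → G) (γ : ℕ → FiniteArchimedeanClass G)
    (hxS : ∀ n, x n ∈ S) (hc : ∀ n, c.coord (γ n) (x n) ≠ 0)
    (hinj : Function.Injective fun n => (x n, γ n)) :
    ¬ Antitone fun n => x n + (σ (γ n) : G) := by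
  intro hanti
  obtain ⟨e, he⟩ := hS.exists_monotone_subseq hxS
  have hγ : StrictAnti (γ ∘ e) := by
    intro m n hmn
    have h1 : x (e m) ≤ x (e n) := he hmn.le
    have h2 : x (e n) + (σ (γ (e n)) : G) ≤ x (e m) + (σ (γ (e m)) : G) :=
      hanti (e.monotone hmn.le)
    have h3 : (σ (γ (e n)) : G) ≤ σ (γ (e m)) := by
      by_contra hcon
      exact (add_lt_add_of_le_of_lt h1 (not_le.1 hcon)).not_ge h2
    refine lt_of_le_of_ne (hσ.le_iff_le.1 h3) fun heq => ?_
    simp only [Function.comp_apply] at heq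
    rw [heq] at h2
    have h4 := le_antisymm h1 (le_of_add_le_add_right h2)
    exact (e.strictMono hmn).ne (hinj (Prod.ext h4 heq.symm))
  refine Set.isWF_iff_no_descending_seq.1 (c.isWF_support (x (e 0))) _ hγ fun n => ?_
  have h0 : c.coord (γ (e n)) (x (e n) - x (e 0)) = 0 := by
    apply c.coord_eq_zero
    refine (hs (γ (e n))).trans_le (ArchimedeanClass.mk_le_mk_of_abs ?_)
    have h1 : x (e 0) ≤ x (e n) := he (Nat.zero_le n)
    rw [abs_of_nonneg (sub_nonneg.2 h1), abs_of_nonpos (σ (γ (e n))).2]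
    have h2 : x (e n) + (σ (γ (e n)) : G) ≤ x (e 0) + (σ (γ (e 0)) : G) :=
      hanti (e.monotone (Nat.zero_le n))
    have h3 : (σ (γ (e 0)) : G) ≤ 0 := (σ (γ (e 0))).2
    rw [sub_le_iff_le_add', ← sub_eq_add_neg, le_sub_iff_add_le]
    exact h2.trans (add_le_of_nonpos_right h3)
  rw [map_sub, sub_eq_zero] at h0
  exact fun h => hc (e n) (h0.trans h)

/-! ### The summed derivation and its leading term -/

section Derivation

variable {k G : Type*} [Field k] [LinearOrder k] [IsStrictOrderedRing k]
  [AddCommGroup G] [LinearOrder G] [IsOrderedAddMonoid G]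

namespace HahnCoordinates

variable (c : HahnCoordinates k G) {σ : FiniteArchimedeanClass G → {g : G // g ≤ 0}}
  (hσ : StrictMono σ) (hs : IsRightShift σ)

/-- The summands `t ^ (σ γ) * D_γ a`, where `D_γ (t ^ g) = - g_γ t ^ g` for the coordinate `g_γ`
of `g` at `γ`. -/
noncomputable def family (a : HahnSeries G k) :
    HahnSeries.SummableFamily G k (FiniteArchimedeanClass G) where
  toFun γ := HahnSeries.single (σ γ : G) 1 * coeffDerivation (-c.coord γ) a
  isPWO_iUnion_support' := by
    -- A descending sequence of exponents has the form `x n + σ (γ n)`, with `x n` in the support of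
    -- `a` and nonzero coordinate at `γ n`.
    rw [Set.isPWO_iff_isWF, Set.isWF_iff_no_descending_seq]
    intro y hy hmem
    simp only [Set.mem_iUnion, HahnSeries.mem_support, HahnSeries.coeff_single_mul,
      coeff_coeffDerivation, one_mul, AddMonoidHom.neg_apply, ne_eq, mul_eq_zero, not_or,
      neg_eq_zero] at hmem
    choose γ hγ using hmem
    refine c.not_antitone hσ hs a.isPWO_support (fun n => y n - σ (γ n)) γ (fun n => (hγ n).2)
      (fun n => (hγ n).1) (fun m n hmn => ?_) ?_
    · simp only [Prod.mk.injEq] at hmn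
      rw [hmn.2] at hmn
      exact hy.injective (sub_left_injective hmn.1)
    · simpa using hy.antitone
  finite_co_support' g := by
    -- Infinitely many contributions to one exponent `g` give a constant, hence antitone, sequence
    -- `x n + σ (γ n)`.
    by_contra hinf
    let γ := Set.Infinite.natEmbedding _ hinf
    have hγ : ∀ n, _ := fun n => (γ n).2
    simp only [Set.mem_ofPred_eq, HahnSeries.coeff_single_mul,
      coeff_coeffDerivation, one_mul, AddMonoidHom.neg_apply, ne_eq, mul_eq_zero, not_or,
      neg_eq_zero] at hγ
    refine c.not_antitone hσ hs a.isPWO_support (fun n => g - σ (γ n)) (fun n => γ n)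
      (fun n => (hγ n).2) (fun n => (hγ n).1) (fun m n hmn => ?_) ?_
    · exact γ.injective (Subtype.ext (Prod.ext_iff.1 hmn).2)
    · simpa using antitone_const

/-- The derivation `D a = ∑ γ, t ^ (σ γ) * D_γ a`. -/
noncomputable def derivation : Derivation ℤ (HahnSeries G k) (HahnSeries G k) :=
  Derivation.mk' (AddMonoidHom.toIntLinearMap
    { toFun := fun a => (c.family hσ hs a).hsum
      map_zero' := by
        rw [← HahnSeries.SummableFamily.hsum_zero (Γ := G) (R := k)]
        congr 1
        ext1 γ
        simp [family]
      map_add' := fun a b => by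
        rw [← HahnSeries.SummableFamily.hsum_add]
        congr 1
        ext1 γ
        simp [family, mul_add] }) (by
    intro a b
    simp only [AddMonoidHom.coe_toIntLinearMap, AddMonoidHom.coe_mk, ZeroHom.coe_mk, smul_eq_mul]
    rw [← HahnSeries.SummableFamily.hsum_smul, ← HahnSeries.SummableFamily.hsum_smul,
      ← HahnSeries.SummableFamily.hsum_add]
    congr 1
    ext1 γ
    simp only [family, HahnSeries.SummableFamily.coe_mk, HahnSeries.SummableFamily.add_apply,
      HahnSeries.SummableFamily.smul_apply, HahnSeries.of_symm_smul_of_eq_mul, Derivation.leibniz,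
      smul_eq_mul]
    ring)

theorem derivation_apply (a : HahnSeries G k) :
    c.derivation hσ hs a = (c.family hσ hs a).hsum := rfl

theorem coeff_family (a : HahnSeries G k) (γ : FiniteArchimedeanClass G) (g : G) :
    (c.family hσ hs a γ).coeff g = -c.coord γ (g - σ γ) * a.coeff (g - σ γ) := by
  change (HahnSeries.single (σ γ : G) 1 * coeffDerivation (-c.coord γ) a).coeff g = _
  rw [HahnSeries.coeff_single_mul, one_mul]
  rfl

theorem coord_mk_neg {g : G} (hg : g < 0) : c.coord (FiniteArchimedeanClass.mk g hg.ne) g < 0 := by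
  have := c.coord_mk_pos (-g) (neg_pos.2 hg)
  rw [FiniteArchimedeanClass.mk_neg hg.ne, map_neg] at this
  exact neg_pos.1 this

theorem coord_mk_ne_zero {g : G} (hg : g ≠ 0) :
    c.coord (FiniteArchimedeanClass.mk g hg) g ≠ 0 := by
  rcases hg.lt_or_gt with h | h
  · exact (c.coord_mk_neg h).ne
  · exact (c.coord_mk_pos g h).ne'

theorem derivation_eq_zero {a : HahnSeries G k} (ha : ∀ g ≠ 0, a.coeff g = 0) :
    c.derivation hσ hs a = 0 := by
  ext y
  rw [derivation_apply, HahnSeries.SummableFamily.coeff_hsum, HahnSeries.coeff_zero]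
  refine finsum_eq_zero_of_forall_eq_zero fun γ => ?_
  rw [coeff_family]
  by_cases h : y - σ γ = 0
  · simp [h]
  · simp [ha _ h]

/-- The constant term contributes nothing. A contribution from `x ≠ 0` at `γ` has `v_G x ≤ γ` and `g
≤ x`, so its exponent satisfies `x + σ γ ≥ x + σ (v_G x) ≥ g + σ (v_G g)`, with equality throughout
only for `x = g` and `γ = v_G g`. -/
theorem coeff_family_eq_zero {a : HahnSeries G k} {g : G} (hg : g ≠ 0)
    (hmin : ∀ x ≠ 0, a.coeff x ≠ 0 → g ≤ x) {γ : FiniteArchimedeanClass G} {y : G}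
    (hy : y ≤ g + σ (FiniteArchimedeanClass.mk g hg))
    (hne : y ≠ g + σ (FiniteArchimedeanClass.mk g hg) ∨ γ ≠ FiniteArchimedeanClass.mk g hg) :
    (c.family hσ hs a γ).coeff y = 0 := by
  by_contra hcon
  rw [coeff_family, mul_eq_zero, neg_eq_zero, not_or] at hcon
  obtain ⟨x, rfl⟩ : ∃ x, y = x + σ γ := ⟨y - σ γ, by simp⟩
  rw [add_sub_cancel_right] at hcon
  have hx : x ≠ 0 := by
    rintro rfl
    simp at hcon
  have hxγ : FiniteArchimedeanClass.mk x hx ≤ γ := by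
    by_contra hlt
    exact hcon.1 (c.coord_eq_zero γ x (not_le.1 hlt))
  have h1 : x + (σ (FiniteArchimedeanClass.mk x hx) : G) ≤ x + σ γ :=
    add_le_add_right (Subtype.coe_le_coe.2 (hσ.monotone hxγ)) x
  rcases (hmin x hx hcon.2).eq_or_lt with rfl | hlt
  · have h2 : σ γ = σ (FiniteArchimedeanClass.mk g hg) :=
      Subtype.ext (add_left_cancel (le_antisymm hy h1))
    rw [hσ.injective h2] at hne
    simp at hne
  · exact ((hs.add_lt_add hσ hg hx hlt).trans_le h1).not_ge hy

theorem coeff_derivation_of_lt {a : HahnSeries G k} {g : G} (hg : g ≠ 0)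
    (hmin : ∀ x ≠ 0, a.coeff x ≠ 0 → g ≤ x) {y : G}
    (hy : y < g + σ (FiniteArchimedeanClass.mk g hg)) :
    (c.derivation hσ hs a).coeff y = 0 := by
  rw [derivation_apply, HahnSeries.SummableFamily.coeff_hsum]
  exact finsum_eq_zero_of_forall_eq_zero fun γ =>
    c.coeff_family_eq_zero hσ hs hg hmin hy.le (Or.inl hy.ne)

theorem coeff_derivation {a : HahnSeries G k} {g : G} (hg : g ≠ 0)
    (hmin : ∀ x ≠ 0, a.coeff x ≠ 0 → g ≤ x) :
    (c.derivation hσ hs a).coeff (g + σ (FiniteArchimedeanClass.mk g hg)) =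
      -c.coord (FiniteArchimedeanClass.mk g hg) g * a.coeff g := by
  rw [derivation_apply, HahnSeries.SummableFamily.coeff_hsum,
    finsum_eq_single _ (FiniteArchimedeanClass.mk g hg) fun γ hγ =>
      c.coeff_family_eq_zero hσ hs hg hmin le_rfl (Or.inr hγ),
    coeff_family, add_sub_cancel_right]

theorem orderTop_derivation {a : HahnSeries G k} {g : G} (hg : g ≠ 0) (hag : a.coeff g ≠ 0)
    (hmin : ∀ x ≠ 0, a.coeff x ≠ 0 → g ≤ x) :
    (c.derivation hσ hs a).orderTop =
      ((g + σ (FiniteArchimedeanClass.mk g hg) : G) : WithTop G) := by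
  refine le_antisymm (HahnSeries.orderTop_le_of_coeff_ne_zero ?_) ?_
  · rw [c.coeff_derivation hσ hs hg hmin]
    exact mul_ne_zero (neg_ne_zero.2 (c.coord_mk_ne_zero hg)) hag
  · exact HahnSeries.le_orderTop_iff_forall.2 fun y hy =>
      c.coeff_derivation_of_lt hσ hs hg hmin (WithTop.coe_lt_coe.1 hy)

end HahnCoordinates

end Derivation

/-! ### Valuation and order on `k((G))` -/

section PowerSeries

variable {k G : Type*} [Field k] [LinearOrder k] [IsStrictOrderedRing k]
  [AddCommGroup G] [LinearOrder G] [IsOrderedAddMonoid G]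

theorem powerSeriesVal_apply (a : OrderedPowerSeries k G) :
    powerSeriesVal k G a = (ofLex a).orderTop := rfl

theorem powerSeriesVal_div {a b : OrderedPowerSeries k G} {g h : G}
    (ha : powerSeriesVal k G a = g) (hb : powerSeriesVal k G b = h) :
    powerSeriesVal k G (a / b) = ((g - h : G) : WithTop G) := by
  have hb0 : b ≠ 0 := by
    rintro rfl
    simp at hb
  have := (powerSeriesVal k G).map_mul (a / b) b
  rw [div_mul_cancel₀ _ hb0, ha, hb] at this
  cases hx : powerSeriesVal k G (a / b) with
  | top => simp [hx] at this
  | coe x =>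
    rw [hx, ← WithTop.coe_add, WithTop.coe_inj] at this
    rw [this, add_sub_cancel_right]

theorem powerSeriesVal_le_of_abs_le {a b : OrderedPowerSeries k G} (h : |a| ≤ |b|) :
    powerSeriesVal k G b ≤ powerSeriesVal k G a := by
  by_contra hcon
  exact (HahnSeries.abs_lt_abs_of_orderTop_ofLex (not_le.1 hcon)).not_ge h

theorem coeff_pos_of_pos {a : OrderedPowerSeries k G} (ha : 0 < a) {g : G}
    (hg : powerSeriesVal k G a = g) : 0 < (ofLex a).coeff g := by
  obtain ⟨i, hlt, hi⟩ := (HahnSeries.lt_iff _ _).1 ha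
  have hi' : (ofLex a).orderTop = i := HahnSeries.orderTop_eq_of_le
    (HahnSeries.mem_support _ _ |>.2 (by simpa using hi.ne')) fun j hj => by
      by_contra hcon
      exact hj (by simpa using (hlt j (not_le.1 hcon)).symm)
  rw [powerSeriesVal_apply, hi', WithTop.coe_inj] at hg
  simpa [hg] using hi

theorem powerSeriesVal_monomial (g : G) {r : k} (hr : r ≠ 0) :
    powerSeriesVal k G (toLex (HahnSeries.single g r)) = g :=
  HahnSeries.orderTop_single hr

theorem powerSeriesVal_surjective : Function.Surjective (powerSeriesVal k G) := by
  intro g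
  cases g with
  | top => exact ⟨0, AddValuation.map_zero _⟩
  | coe g => exact ⟨_, powerSeriesVal_monomial g one_ne_zero⟩

/-- A derivation of `k((G))`, on the same field with its order. -/
noncomputable def Derivation.toOrderedPowerSeries
    (D : Derivation ℤ (HahnSeries G k) (HahnSeries G k)) :
    Derivation ℤ (OrderedPowerSeries k G) (OrderedPowerSeries k G) :=
  Derivation.mk' (AddMonoidHom.toIntLinearMap
    { toFun := fun a => toLex (D (ofLex a))
      map_zero' := by simp
      map_add' := fun a b => by simp }) fun a b => D.leibniz (ofLex a) (ofLex b)

/-! ### The summed derivation is of Hardy type -/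

namespace HahnCoordinates

variable (c : HahnCoordinates k G) {σ : FiniteArchimedeanClass G → {g : G // g ≤ 0}}
  (hσ : StrictMono σ) (hs : IsRightShift σ)

theorem val_derivation {a : OrderedPowerSeries k G} {g : G} (hg : g ≠ 0)
    (ha : powerSeriesVal k G a = g) :
    powerSeriesVal k G ((c.derivation hσ hs).toOrderedPowerSeries a) =
      ((g + σ (FiniteArchimedeanClass.mk g hg) : G) : WithTop G) :=
  c.orderTop_derivation hσ hs hg (HahnSeries.coeff_orderTop_ne ha) fun _ _ hx =>
    WithTop.coe_le_coe.1 (ha.symm.trans_le (HahnSeries.orderTop_le_of_coeff_ne_zero hx))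

theorem val_logDeriv {a : OrderedPowerSeries k G} {g : G} (hg : g ≠ 0)
    (ha : powerSeriesVal k G a = g) :
    powerSeriesVal k G ((c.derivation hσ hs).toOrderedPowerSeries a / a) =
      ((σ (FiniteArchimedeanClass.mk g hg) : G) : WithTop G) := by
  rw [powerSeriesVal_div (c.val_derivation hσ hs hg ha) ha, add_sub_cancel_left]

/-- The relevant exponent is the least nonzero one in the support, which need not be `v a`: a
constant term may precede it. -/
theorem forall_coeff_eq_zero_or_val_derivation (a : OrderedPowerSeries k G) :
    (∀ g ≠ 0, (ofLex a).coeff g = 0) ∨ ∃ (g : G) (hg : g ≠ 0), (ofLex a).coeff g ≠ 0 ∧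
      powerSeriesVal k G ((c.derivation hσ hs).toOrderedPowerSeries a) =
        ((g + σ (FiniteArchimedeanClass.mk g hg) : G) : WithTop G) := by
  by_cases h : ∀ g ≠ 0, (ofLex a).coeff g = 0
  · exact Or.inl h
  push Not at h
  obtain ⟨x, hx0, hx⟩ := h
  have hwf : {g : G | g ≠ 0 ∧ (ofLex a).coeff g ≠ 0}.IsWF :=
    (ofLex a).isPWO_support.isWF.mono fun g hg => hg.2
  have hmem := hwf.min_mem ⟨x, hx0, hx⟩
  exact Or.inr ⟨_, hmem.1, hmem.2, c.orderTop_derivation hσ hs hmem.1 hmem.2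
    fun y hy0 hy => hwf.min_le _ ⟨hy0, hy⟩⟩

theorem derivation_eq_zero_iff (a : OrderedPowerSeries k G) :
    (c.derivation hσ hs).toOrderedPowerSeries a = 0 ↔ ∀ g ≠ 0, (ofLex a).coeff g = 0 := by
  refine ⟨fun h => ?_, fun h => c.derivation_eq_zero hσ hs h⟩
  refine (c.forall_coeff_eq_zero_or_val_derivation hσ hs a).resolve_right ?_
  rintro ⟨g, hg, -, hval⟩
  rw [h, AddValuation.map_zero] at hval
  exact WithTop.top_ne_coe hval

theorem derivation_single_zero (r : k) :
    (c.derivation hσ hs).toOrderedPowerSeries (toLex (HahnSeries.single 0 r)) = 0 :=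
  (c.derivation_eq_zero_iff hσ hs _).2 fun _ hg => HahnSeries.coeff_single_of_ne hg

theorem isPreDifferentialValued_derivation :
    IsPreDifferentialValued (powerSeriesVal k G) (c.derivation hσ hs).toOrderedPowerSeries := by
  intro a b ha hb hb0
  cases hv : powerSeriesVal k G b with
  | top => exact absurd ((powerSeriesVal k G).top_iff.1 hv) hb0
  | coe h =>
    rw [hv] at hb
    rw [c.val_logDeriv hσ hs (WithTop.coe_pos.1 hb).ne' hv]
    rcases c.forall_coeff_eq_zero_or_val_derivation hσ hs a with h0 | ⟨g, hg, hag, hval⟩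
    · rw [(c.derivation_eq_zero_iff hσ hs a).2 h0, AddValuation.map_zero]
      exact WithTop.coe_lt_top _
    · have hg0 : 0 ≤ g :=
        WithTop.coe_nonneg.1 (ha.trans (HahnSeries.orderTop_le_of_coeff_ne_zero hag))
      rw [hval, WithTop.coe_lt_coe, add_comm]
      simpa [abs_of_nonneg hg0] using hs.lt_add_abs hσ _ hg

theorem isHField_derivation :
    IsHField (powerSeriesVal k G) (c.derivation hσ hs).toOrderedPowerSeries where
  preDifferentialValued := c.isPreDifferentialValued_derivation hσ hs
  convex := by
    refine ⟨fun x hx y hy z hz => ?_⟩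
    rcases le_max_iff.1 (abs_le_max_abs_abs hz.1 hz.2) with h | h
    · exact le_trans hx (powerSeriesVal_le_of_abs_le h)
    · exact le_trans hy (powerSeriesVal_le_of_abs_le h)
  deriv_pos a ha := by
    have ha0 : 0 < a := ha 0 (by simp)
    have hva : powerSeriesVal k G a < 0 := by
      by_contra hcon
      exact lt_irrefl a (ha a (not_lt.1 hcon))
    obtain ⟨g, hg⟩ := WithTop.ne_top_iff_exists.1 (hva.trans_le le_top).ne
    rw [← hg] at hva
    have hg0 : g < 0 := WithTop.coe_lt_coe.1 hva
    have hmin : ∀ x ≠ 0, (ofLex a).coeff x ≠ 0 → g ≤ x := fun x _ hx =>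
      WithTop.coe_le_coe.1 (hg.trans_le (HahnSeries.orderTop_le_of_coeff_ne_zero hx))
    refine (HahnSeries.lt_iff _ _).2 ⟨g + σ (FiniteArchimedeanClass.mk g hg0.ne), ?_, ?_⟩
    · intro j hj
      exact (c.coeff_derivation_of_lt hσ hs hg0.ne hmin hj).symm
    · refine lt_of_lt_of_eq ?_ (c.coeff_derivation hσ hs hg0.ne hmin).symm
      -- The sign in the definition of `D` is used here: infinite elements have exponent `g < 0`,
      -- whose leading coordinate is negative.
      exact mul_pos (neg_pos.2 (c.coord_mk_neg hg0)) (coeff_pos_of_pos ha0 hg.symm)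
  valuationRing_eq := by
    ext a
    constructor
    · intro ha
      -- Adding `1` settles the comparison at exponent `0`, whatever the higher terms of `|a|`.
      refine ⟨toLex (HahnSeries.single 0 ((ofLex |a|).coeff 0 + 1)),
        c.derivation_single_zero hσ hs _, le_of_lt ((HahnSeries.lt_iff _ _).2 ⟨0, ?_, ?_⟩)⟩
      · intro j hj
        rw [ofLex_toLex, HahnSeries.coeff_single_of_ne hj.ne]
        apply HahnSeries.coeff_eq_zero_of_lt_orderTop
        rw [HahnSeries.orderTop_abs]
        exact (WithTop.coe_lt_coe.2 hj).trans_le ha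
      · simp
    · rintro ⟨x, hx, hax⟩
      refine le_trans ?_ (powerSeriesVal_le_of_abs_le (hax.trans (le_abs_self x)))
      refine HahnSeries.le_orderTop_iff_forall.2 fun y hy => ?_
      exact (c.derivation_eq_zero_iff hσ hs x).1 hx y (WithTop.coe_lt_coe.1 hy).ne
  eq_constants_add := by
    ext a
    rw [Set.mem_add]
    constructor
    · intro ha
      refine ⟨toLex (HahnSeries.single 0 ((ofLex a).coeff 0)), c.derivation_single_zero hσ hs _,
        a - toLex (HahnSeries.single 0 ((ofLex a).coeff 0)), ?_, add_sub_cancel _ _⟩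
      change (0 : WithTop G) < HahnSeries.orderTop _
      refine lt_of_le_of_ne (HahnSeries.le_orderTop_iff_forall.2 fun y hy => ?_)
        (HahnSeries.orderTop_ne_of_coeff_eq_zero ?_).symm
      · have hy0 : y < 0 := WithTop.coe_lt_coe.1 hy
        simp [HahnSeries.coeff_single_of_ne hy0.ne,
          HahnSeries.coeff_eq_zero_of_lt_orderTop (hy.trans_le ha)]
      · simp
    · rintro ⟨x, hx, y, hy, rfl⟩
      refine le_trans (le_min ?_ (le_of_lt hy)) ((powerSeriesVal k G).map_add x y)
      refine HahnSeries.le_orderTop_iff_forall.2 fun y hy => ?_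
      exact (c.derivation_eq_zero_iff hσ hs x).1 hx y (WithTop.coe_lt_coe.1 hy).ne

theorem isHardyTypeDerivation :
    IsHardyTypeDerivation (powerSeriesVal k G) (c.derivation hσ hs).toOrderedPowerSeries :=
  ⟨c.isHField_derivation hσ hs, _,
    ⟨powerSeriesVal_surjective, fun _ g ha => c.val_logDeriv hσ hs g.2 ha⟩,
    hs.isHardyTypeCouple hσ⟩

end HahnCoordinates

/-! ### Logarithmic derivatives of monomials -/

section LogDeriv

variable (D : Derivation ℤ (OrderedPowerSeries k G) (OrderedPowerSeries k G))

/-- The logarithmic derivative of `t ^ g`, as an additive map. -/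
noncomputable def monomialLogDeriv : G →+ OrderedPowerSeries k G where
  toFun g := D (toLex (HahnSeries.single g 1)) / toLex (HahnSeries.single g 1)
  map_zero' := by
    have : toLex (HahnSeries.single (0 : G) (1 : k)) = (1 : OrderedPowerSeries k G) := rfl
    rw [this, D.map_one_eq_zero, zero_div]
  map_add' g h := by
    have hmul : toLex (HahnSeries.single (g + h) (1 : k)) =
        (toLex (HahnSeries.single g 1) * toLex (HahnSeries.single h 1) :
          OrderedPowerSeries k G) := by
      refine congrArg toLex (Eq.symm ?_)
      refine (HahnSeries.single_mul_single (R := k)).trans ?_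
      rw [one_mul]
    have hne : ∀ g : G, (toLex (HahnSeries.single g 1) : OrderedPowerSeries k G) ≠ 0 :=
      fun g h0 => one_ne_zero (HahnSeries.single_eq_zero_iff.1 (congrArg ofLex h0))
    rw [hmul, D.leibniz, smul_eq_mul, smul_eq_mul]
    field_simp [hne g, hne h]
    ring

variable {D}

theorem val_monomialLogDeriv {ψ : {g : G // g ≠ 0} → G}
    (hψ : HasAsymptoticCouple (powerSeriesVal k G) D ψ) {g : G} (hg : g ≠ 0) :
    powerSeriesVal k G (monomialLogDeriv D g) = ψ ⟨g, hg⟩ :=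
  hψ.2 _ ⟨g, hg⟩ (powerSeriesVal_monomial g one_ne_zero)

theorem monomialLogDeriv_pos (hD : IsPreHField (powerSeriesVal k G) D) {g : G} (hg : g < 0) :
    0 < monomialLogDeriv D g := by
  have hlt : ∀ b : OrderedPowerSeries k G, 0 ≤ powerSeriesVal k G b →
      b < toLex (HahnSeries.single g 1) := by
    intro b hb
    refine (HahnSeries.lt_iff _ _).2 ⟨g, fun j hj => ?_, ?_⟩
    · rw [ofLex_toLex, HahnSeries.coeff_single_of_ne hj.ne]
      exact HahnSeries.coeff_eq_zero_of_lt_orderTop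
        ((WithTop.coe_lt_coe.2 (hj.trans hg)).trans_le hb)
    · rw [ofLex_toLex, HahnSeries.coeff_single_same, HahnSeries.coeff_eq_zero_of_lt_orderTop
        ((WithTop.coe_lt_coe.2 hg).trans_le hb)]
      exact one_pos
  exact div_pos (hD.deriv_pos _ hlt) (hlt 0 (by simp))

/-- The logarithmic derivatives of `t ^ g` and `t ^ (-g)` differ only in sign. -/
theorem psi_neg {ψ : {g : G // g ≠ 0} → G}
    (hψ : HasAsymptoticCouple (powerSeriesVal k G) D ψ) (g h : {g : G // g ≠ 0})
    (hgh : (h : G) = -g) : ψ h = ψ g := by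
  obtain ⟨h, hh⟩ := h
  subst hgh
  have h1 := val_monomialLogDeriv hψ hh
  rw [map_neg, AddValuation.map_neg, val_monomialLogDeriv hψ g.2] at h1
  exact (WithTop.coe_inj.1 h1).symm

/-- On `G^γ` the logarithmic derivative has value at least `s γ`, with equality exactly off `G_γ`;
so the coefficient at `s γ` is the leading one off `G_γ` and zero on it. Negating the exponent makes
it positive for `g > 0`, since `t ^ (-g)` is then infinite. -/
theorem embedsInto_of_isHardyTypeDerivation
    (hD : IsHardyTypeDerivation (powerSeriesVal k G) D) (γ : FiniteArchimedeanClass G) :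
    ArchComponent.EmbedsInto γ k := by
  obtain ⟨hH, ψ, hψ, hardy⟩ := hD
  obtain ⟨s, hs, hsψ⟩ := hardy.exists_strictMono (psi_neg hψ)
  have hval : ∀ (g : G) (hg : g ≠ 0), powerSeriesVal k G (monomialLogDeriv D (-g)) =
      (s (FiniteArchimedeanClass.mk g hg) : WithTop G) := by
    intro g hg
    rw [map_neg, AddValuation.map_neg, val_monomialLogDeriv hψ hg, hsψ ⟨g, hg⟩]
  refine ArchComponent.embedsInto_of_addMonoidHom
    (((HahnSeries.coeff.addMonoidHom (s γ)).comp ((monomialLogDeriv D).comp negAddMonoidHom)).comp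
      (FiniteArchimedeanClass.closedBallAddSubgroup γ).subtype) ?_ ?_
  · intro g hg
    by_cases hg0 : (g : G) = 0
    · simp [hg0]
    · change (ofLex (monomialLogDeriv D (-(g : G)))).coeff (s γ) = 0
      refine HahnSeries.coeff_eq_zero_of_lt_orderTop (lt_of_lt_of_eq ?_ (hval g hg0).symm)
      exact WithTop.coe_lt_coe.2 (hs (FiniteArchimedeanClass.mem_ballAddSubgroup_iff.1 hg hg0))
  · intro g hg hpos
    have hg0 : (g : G) ≠ 0 := fun h => hpos.ne' (Subtype.ext h)
    refine coeff_pos_of_pos (monomialLogDeriv_pos hH.toIsPreHField (neg_neg_of_pos hpos))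
      ((hval g hg0).trans (congrArg _ (congrArg s ?_)))
    refine le_antisymm ?_ (FiniteArchimedeanClass.mem_closedBallAddSubgroup_iff.1 g.2 hg0)
    by_contra hlt
    exact hg (FiniteArchimedeanClass.mem_ballAddSubgroup_iff.2 fun _ => not_le.1 hlt)

end LogDeriv

end PowerSeries

theorem mainTheorem8 (k G : Type*) [Field k] [LinearOrder k] [IsStrictOrderedRing k]
    [AddCommGroup G] [LinearOrder G] [IsOrderedAddMonoid G] :
    (∃ D : Derivation ℤ (OrderedPowerSeries k G) (OrderedPowerSeries k G),
        IsHardyTypeDerivation (powerSeriesVal k G) D) ↔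
      ((∀ γ : FiniteArchimedeanClass G, ArchComponent.EmbedsInto γ k) ∧
        ∃ σ : FiniteArchimedeanClass G → {g : G // g ≤ 0}, StrictMono σ ∧ IsRightShift σ) := by
  constructor
  · rintro ⟨D, hD⟩
    refine ⟨embedsInto_of_isHardyTypeDerivation hD, ?_⟩
    obtain ⟨-, ψ, hψ, hardy⟩ := hD
    exact hardy.exists_isRightShift (psi_neg hψ)
  · rintro ⟨hemb, σ, hσ, hs⟩
    obtain ⟨c⟩ := HahnCoordinates.nonempty_of_embedsInto hemb
    exact ⟨_, c.isHardyTypeDerivation hσ hs⟩
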